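/- Let $\mathbb{F}_2^n$ be the vector space over the field with two elements with standard basis $e_1,\dots,e_n$, and for $0\le m\le n$ regard $\mathbb{F}_2^m$ as the subspace of $\mathbb{F}_2^n$ consisting of the vectors $x=(x_1,\dots,x_n)$ with $x_i=0$ for all $i>m$. A set $A\subseteq\mathbb{F}_2^n$ is a shift-minimal downset (SMD) if (a) whenever $1\le i\le n$, $x\in\mathbb{F}_2^n$, $x_i=0$ and $x+e_i\in A$, also $x\in A$; and (b) whenever $1\le i<j\le n$, $x\in\mathbb{F}_2^n$, $x_i=x_j=0$ and $x+e_j\in A$, also $x+e_i\in A$. For non-empty $A$ let $\sigma[A]:=|A+A|/|A|$ be its doubling constant, where $A+A=\{a+b: a,b\in A\}$. There is an absolute constant $c>0$ such that the following holds. Let $n\ge 0$ be an integer, let $A\subseteq\mathbb{F}_2^n$ be a non-empty SMD, let $K$ be a real number with $\sigma[A]\le K$, and set $m:=\lfloor\log_2|A|\rfloor$. Then $$|A\cap\mathbb{F}_2^m|\ \ge\ c\,K^{-29}\,|A|.$$ -/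

import Mathlib

open scoped Pointwise

namespace F2Vec

/-- `A ⊆ 𝔽₂^I` is a downset: whenever `x ⊥ e_i` (that is, `x i = 0`) and `x + e_i ∈ A`,
also `x ∈ A`. -/
def IsDownset {I : Type*} [DecidableEq I] (A : Set (I → ZMod 2)) : Prop :=
  ∀ (i : I) (x : I → ZMod 2), x i = 0 → x + Pi.single i 1 ∈ A → x ∈ A

/-- `A ⊆ 𝔽₂^I` is shift-minimal: whenever `i < j`, `x ⊥ e_i`, `x ⊥ e_j` and `x + e_j ∈ A`,
also `x + e_i ∈ A`. -/
def IsShiftMinimal {I : Type*} [LinearOrder I] (A : Set (I → ZMod 2)) : Prop :=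
  ∀ (i j : I) (x : I → ZMod 2), i < j → x i = 0 → x j = 0 →
    x + Pi.single j 1 ∈ A → x + Pi.single i 1 ∈ A

/-- Shift-minimal downsets. -/
def IsSMD {I : Type*} [LinearOrder I] (A : Set (I → ZMod 2)) : Prop :=
  IsDownset A ∧ IsShiftMinimal A

/-- The coordinate subspace `𝔽₂^J` of `𝔽₂^I`, embedded by extending by zeroes. -/
def coordSubspace {I : Type*} (J : Set I) : Submodule (ZMod 2) (I → ZMod 2) where
  carrier := {x | ∀ i, i ∉ J → x i = 0}
  zero_mem' := fun _ _ => rfl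
  add_mem' := fun hx hy i hi => by simp [hx i hi, hy i hi]
  smul_mem' := fun c x hx i hi => by simp [hx i hi]

/-- `𝔽₂^m` inside `𝔽₂^n`: the vectors supported on the first `m` coordinates
(the coordinates `1, …, n` are indexed by `Fin n`, starting from `0`). -/
def initialSubspace (n m : ℕ) : Submodule (ZMod 2) (Fin n → ZMod 2) :=
  coordSubspace {i : Fin n | (i : ℕ) < m}

end F2Vec

/-! Let X and Y be independent and uniform on A, with coordinates revealed from the last to the
first. Given the later coordinates, X_j is a bit whose mean p is at most 1/2, because A is a
downset. By the chain rule log|A| is the sum over j of E h(p), with h the binary entropy, while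
log|A+A| is at least the sum of E h(p*q), where q is the mean for Y and p*q that of the sum of the
bits (`sum_binEntropy_bitConv_le`). Hence the gains E h(p*q) - E h(p), all nonnegative, add up to at
most log K.

By shift-minimality the unconditional mean of X_j decreases in j; its value at m is compared with
1/56. If it is smaller, each level from m on gains at least 1/28 of its entropy
(`sum_binEntropy_le_gain`). If it is larger, each level before m gains at least 1/28 of its deficit
from log 2 (`log_two_sub_le_gain`), so these levels carry at least m log 2 - 28 log K of the total
log|A| ≤ (m+1) log 2. Either way the levels from m on carry at most 28 log K + log 2. Their entropy
is the average of log(|A|/|F|), F being the fibre of A with the same coordinates from m on as X, and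
no such fibre is larger than A ∩ 𝔽₂^m. -/

namespace F2Vec

open Real

/-! ### Binary entropy of a sum of two bits -/

/-- If `X` and `Y` are independent bits with means `p` and `q`, then `bitConv p q` is the mean of
the bit `X + Y`. -/
noncomputable def bitConv (p q : ℝ) : ℝ := p * (1 - q) + q * (1 - p)

lemma bitConv_comm (p q : ℝ) : bitConv p q = bitConv q p := by
  unfold bitConv; ring

/-- Adding a bit of mean q amounts to replacing the first bit by a fair one with probability 2q;
concavity of entropy then contracts the deficit. -/
lemma log_two_sub_binEntropy_bitConv_le {p q : ℝ} (hp0 : 0 ≤ p) (hp : p ≤ 1 / 2) (hq0 : 0 ≤ q)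
    (hq : q ≤ 1 / 2) :
    log 2 - binEntropy (bitConv p q) ≤ (1 - 2 * q) * (log 2 - binEntropy p) := by
  have h := strictConcave_binEntropy.concaveOn.2 (show p ∈ Set.Icc (0 : ℝ) 1 from ⟨hp0, by linarith⟩)
    (show (1 / 2 : ℝ) ∈ Set.Icc (0 : ℝ) 1 from ⟨by norm_num, by norm_num⟩)
    (show 0 ≤ 1 - 2 * q by linarith) (show 0 ≤ 2 * q by linarith) (by ring)
  have e : (1 - 2 * q) • p + (2 * q) • (1 / 2 : ℝ) = bitConv p q := by
    simp only [smul_eq_mul, bitConv]; ring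
  have e2 : binEntropy (1 / 2) = log 2 := by rw [one_div]; exact binEntropy_two_inv
  rw [e, e2] at h
  simp only [smul_eq_mul] at h
  linarith

lemma binEntropy_le_binEntropy_bitConv {p q : ℝ} (hp0 : 0 ≤ p) (hp : p ≤ 1 / 2) (hq0 : 0 ≤ q)
    (hq : q ≤ 1 / 2) : binEntropy p ≤ binEntropy (bitConv p q) := by
  have h := log_two_sub_binEntropy_bitConv_le hp0 hp hq0 hq
  have := binEntropy_le_log_two (p := p)
  nlinarith

lemma binEntropy_le_mul_log {x : ℝ} (h1 : x < 1) :
    binEntropy x ≤ x * (-log x + 1) := by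
  have h := Real.log_le_sub_one_of_pos (x := (1 - x)⁻¹) (inv_pos.2 (by linarith))
  have h2 : (1 - x) * (1 - x)⁻¹ = 1 := mul_inv_cancel₀ (by linarith)
  rw [binEntropy, Real.log_inv x]
  nlinarith [mul_le_mul_of_nonneg_left h (by linarith : 0 ≤ 1 - x)]

lemma mul_log_le_binEntropy {x : ℝ} (h1 : x < 1) :
    x * (-log x + (1 - x)) ≤ binEntropy x := by
  have h := Real.log_le_sub_one_of_pos (x := 1 - x) (by linarith)
  rw [binEntropy, Real.log_inv x, Real.log_inv (1 - x)]
  nlinarith [mul_le_mul_of_nonneg_left h (by linarith : 0 ≤ 1 - x)]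

/-- For small means p*q is close to S = p + q, and both h(p) + h(q) and h(p*q) are asymptotic to S
log(1/S) up to lower order terms. The loss 7/10 must stay above 2/3 for the count in
`sum_binEntropy_le_gain`. -/
lemma binEntropy_add_le_bitConv {p q : ℝ} (hp0 : 0 ≤ p) (hp : p ≤ 1 / 14) (hq0 : 0 ≤ q)
    (hq : q ≤ 1 / 14) :
    7 / 10 * (binEntropy p + binEntropy q) ≤ binEntropy (bitConv p q) := by
  rcases eq_or_lt_of_le (add_nonneg hp0 hq0) with h0 | h0
  · have : p = 0 := by linarith
    have : q = 0 := by linarith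
    subst_vars; simp [bitConv]
  set S := p + q with hS
  have hS1 : S ≤ 1 / 7 := by linarith
  set z := bitConv p q with hz
  have hzS : z ≤ S := by simp only [hz, bitConv, hS]; nlinarith [mul_nonneg hp0 hq0]
  have hz1 : S * (1 - S / 2) ≤ z := by
    simp only [hz, bitConv, hS]; nlinarith [sq_nonneg (p - q)]
  have hzpos : 0 < z := lt_of_lt_of_le (mul_pos h0 (by linarith)) hz1
  have hmid : binEntropy p + binEntropy q ≤ 2 * binEntropy (S / 2) := by
    have h := strictConcave_binEntropy.concaveOn.2 (show p ∈ Set.Icc (0 : ℝ) 1 from ⟨hp0, by linarith⟩)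
      (show q ∈ Set.Icc (0 : ℝ) 1 from ⟨hq0, by linarith⟩)
      (show (0 : ℝ) ≤ 1 / 2 by norm_num) (show (0 : ℝ) ≤ 1 / 2 by norm_num) (by norm_num)
    have e : (1 / 2 : ℝ) • p + (1 / 2 : ℝ) • q = S / 2 := by
      simp only [smul_eq_mul, hS]; ring
    rw [e] at h
    simp only [smul_eq_mul] at h
    linarith
  have hup := binEntropy_le_mul_log (x := S / 2) (by linarith)
  have hlow := mul_log_le_binEntropy (x := z) (by linarith)
  have hlogz : log z ≤ log S := Real.log_le_log hzpos hzS
  have hlogS2 : log (S / 2) = log S - log 2 := Real.log_div h0.ne' (by norm_num)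
  have hl2 := Real.log_two_lt_d9
  have hl2' := Real.log_two_gt_d9
  have hL : 1.8 ≤ -log S := by
    have h1 : log S ≤ log (1 / 7) := Real.log_le_log h0 hS1
    have h2 : log (1 / 7 : ℝ) = log (4 / 7) - 2 * log 2 := by
      have : (1 / 7 : ℝ) = (4 / 7) / 2 ^ 2 := by norm_num
      rw [this, Real.log_div (by norm_num) (by norm_num), Real.log_pow]; norm_num
    have h3 := Real.log_le_sub_one_of_pos (x := (4 / 7 : ℝ)) (by norm_num)
    norm_num at h1 h2 h3 ⊢
    linarith
  set ℓ := -log S with hl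
  rw [hlogS2] at hup
  have k1 : S * (13 / 14) * (ℓ + 6 / 7) ≤ binEntropy z := by
    refine le_trans ?_ hlow
    refine mul_le_mul ?_ (by linarith) (by linarith) hzpos.le
    nlinarith
  -- After division by S the sides are about 2.445 and 2.467 at ℓ = 1.8, and the right one grows
  -- faster in ℓ.
  have k2 : 7 / 10 * (S * (ℓ + log 2 + 1)) ≤ S * (13 / 14) * (ℓ + 6 / 7) := by
    nlinarith [mul_le_mul_of_nonneg_left hL h0.le, mul_le_mul_of_nonneg_left hl2.le h0.le]
  nlinarith

/-! ### Entropy gain averaged over pairs -/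

variable {ι : Type*}

/-- Entropy gain, large mean. -/
lemma log_two_sub_le_gain (s : Finset ι) (P : ι → ℝ) (hP0 : ∀ x ∈ s, 0 ≤ P x)
    (hP : ∀ x ∈ s, P x ≤ 1 / 2) (hmean : (s.card : ℝ) ≤ 56 * ∑ x ∈ s, P x) :
    (s.card : ℝ) * (s.card * log 2 - ∑ x ∈ s, binEntropy (P x)) ≤
      28 * (∑ x ∈ s, ∑ y ∈ s, binEntropy (bitConv (P x) (P y)) -
        s.card * ∑ x ∈ s, binEntropy (P x)) := by
  have h1 : ∑ x ∈ s, ∑ y ∈ s, (log 2 - binEntropy (bitConv (P x) (P y))) ≤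
      ∑ x ∈ s, ∑ y ∈ s, (log 2 - binEntropy (P x)) * (1 - 2 * P y) := by
    refine Finset.sum_le_sum fun x hx => Finset.sum_le_sum fun y hy => ?_
    rw [mul_comm]
    exact log_two_sub_binEntropy_bitConv_le (hP0 x hx) (hP x hx) (hP0 y hy) (hP y hy)
  rw [← Finset.sum_mul_sum] at h1
  simp only [Finset.sum_sub_distrib, Finset.sum_const, nsmul_eq_mul, ← Finset.mul_sum,
    mul_one] at h1
  -- By `h1` the gain is at least 2 ∑ P times this deficit, which gives 28 = 56 / 2.
  have h2 : 0 ≤ s.card * log 2 - ∑ x ∈ s, binEntropy (P x) := by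
    have : ∑ x ∈ s, binEntropy (P x) ≤ ∑ x ∈ s, log 2 :=
      Finset.sum_le_sum fun x _ => binEntropy_le_log_two
    simpa using this
  nlinarith

/-- Entropy gain, small mean. -/
lemma sum_binEntropy_le_gain (s : Finset ι) (P : ι → ℝ) (hP0 : ∀ x ∈ s, 0 ≤ P x)
    (hP : ∀ x ∈ s, P x ≤ 1 / 2) (hmean : 56 * ∑ x ∈ s, P x ≤ s.card) :
    (s.card : ℝ) * ∑ x ∈ s, binEntropy (P x) ≤
      28 * (∑ x ∈ s, ∑ y ∈ s, binEntropy (bitConv (P x) (P y)) -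
        s.card * ∑ x ∈ s, binEntropy (P x)) := by
  classical
  set u : ι → ℝ := fun x => if P x ≤ 1 / 14 then 1 else 0 with hu
  set v : ι → ℝ := fun x => if P x ≤ 1 / 14 then 0 else 1 with hv
  set f : ι → ℝ := fun x => if P x ≤ 1 / 14 then binEntropy (P x) else 0 with hf
  set g : ι → ℝ := fun x => if P x ≤ 1 / 14 then 0 else binEntropy (P x) with hg
  have hH0 : ∀ x ∈ s, 0 ≤ binEntropy (P x) := fun x hx =>
    binEntropy_nonneg (hP0 x hx) (by linarith [hP x hx])
  -- Two small means use the 7/10 bound, a mixed pair keeps the entropy of the large mean, and two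
  -- large means keep the average.
  have key : ∑ x ∈ s, ∑ y ∈ s, (7 / 10 * (f x * u y) + 7 / 10 * (u x * f y) + u x * g y + g x * u y
      + 1 / 2 * (g x * v y) + 1 / 2 * (v x * g y)) ≤
      ∑ x ∈ s, ∑ y ∈ s, binEntropy (bitConv (P x) (P y)) := by
    refine Finset.sum_le_sum fun x hx => Finset.sum_le_sum fun y hy => ?_
    have e1 := binEntropy_le_binEntropy_bitConv (hP0 x hx) (hP x hx) (hP0 y hy) (hP y hy)
    have e2 := binEntropy_le_binEntropy_bitConv (hP0 y hy) (hP y hy) (hP0 x hx) (hP x hx)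
    rw [bitConv_comm] at e2
    simp only [hu, hv, hf, hg]
    split_ifs with h1 h2 h2
    · have := binEntropy_add_le_bitConv (hP0 x hx) h1 (hP0 y hy) h2
      linarith
    all_goals linarith
  simp only [Finset.sum_add_distrib, ← Finset.mul_sum] at key
  simp only [← Finset.sum_mul] at key
  have hfg : ∑ x ∈ s, binEntropy (P x) = ∑ x ∈ s, f x + ∑ x ∈ s, g x := by
    rw [← Finset.sum_add_distrib]
    refine Finset.sum_congr rfl fun x _ => ?_
    simp only [hf, hg]; split_ifs <;> simp
  have huv : (s.card : ℝ) = ∑ x ∈ s, u x + ∑ x ∈ s, v x := by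
    rw [← Finset.sum_add_distrib, Finset.card_eq_sum_ones, Nat.cast_sum]
    refine Finset.sum_congr rfl fun x _ => ?_
    simp only [hu, hv]; split_ifs <;> simp
  have hvP : ∑ x ∈ s, v x ≤ 14 * ∑ x ∈ s, P x := by
    rw [Finset.mul_sum]
    refine Finset.sum_le_sum fun x hx => ?_
    simp only [hv]; split_ifs with h
    · linarith [hP0 x hx]
    · linarith
  have hf0 : 0 ≤ ∑ x ∈ s, f x := Finset.sum_nonneg fun x hx => by
    simp only [hf]; split_ifs; exacts [hH0 x hx, le_rfl]
  have hg0 : 0 ≤ ∑ x ∈ s, g x := Finset.sum_nonneg fun x hx => by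
    simp only [hg]; split_ifs; exacts [le_rfl, hH0 x hx]
  rw [huv] at hmean
  rw [hfg, huv]
  set a := ∑ x ∈ s, f x
  set b := ∑ x ∈ s, g x
  set l := ∑ x ∈ s, u x
  set r := ∑ x ∈ s, v x
  -- Markov: at most 14/56 = 1/4 of the means exceed 1/14. The gain is then at least (2/5 l - r) a +
  -- l b ≥ l a / 15 + l b.
  have hl : 3 * r ≤ l := by linarith
  have hr0 : 0 ≤ r := Finset.sum_nonneg fun x hx => by
    simp only [hv]; split_ifs <;> norm_num
  nlinarith [mul_le_mul_of_nonneg_right hl hf0, mul_le_mul_of_nonneg_right hl hg0,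
    mul_nonneg hr0 hf0, mul_nonneg hr0 hg0]

/-! ### Gibbs' inequality -/

/-- Gibbs' inequality for a two-point distribution, with unnormalised weights. -/
lemma mul_binEntropy_le_cross {n₀ n₁ m₀ m₁ : ℝ} (hn₀ : 0 ≤ n₀) (hn₁ : 0 ≤ n₁) (hm₀ : 0 ≤ m₀)
    (hm₁ : 0 ≤ m₁) (h₀ : 0 < n₀ → 0 < m₀) (h₁ : 0 < n₁ → 0 < m₁) :
    (n₀ + n₁) * binEntropy (n₁ / (n₀ + n₁)) ≤
      n₀ * (log (m₀ + m₁) - log m₀) + n₁ * (log (m₀ + m₁) - log m₁) := by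
  rcases eq_or_lt_of_le hn₀ with e0 | p0
  · subst e0
    rcases eq_or_lt_of_le hn₁ with e1 | p1
    · subst e1; simp
    · have := Real.log_le_log (h₁ p1) (by linarith : m₁ ≤ m₀ + m₁)
      simp only [zero_add, div_self p1.ne', binEntropy_one, mul_zero, zero_mul]
      exact mul_nonneg hn₁ (by linarith)
  rcases eq_or_lt_of_le hn₁ with e1 | p1
  · subst e1
    have := Real.log_le_log (h₀ p0) (by linarith : m₀ ≤ m₀ + m₁)
    simp only [add_zero, zero_div, binEntropy_zero, mul_zero, zero_mul]
    exact mul_nonneg hn₀ (by linarith)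
  have q0 := h₀ p0
  have q1 := h₁ p1
  set n := n₀ + n₁ with hn
  set m := m₀ + m₁ with hm
  have hnp : 0 < n := by linarith
  have hmp : 0 < m := by linarith
  have e : 1 - n₁ / n = n₀ / n := by field_simp; linarith
  rw [binEntropy, e]
  have c1 : n * (n₁ / n * log (n₁ / n)⁻¹ + n₀ / n * log (n₀ / n)⁻¹) =
      n₁ * (log n - log n₁) + n₀ * (log n - log n₀) := by
    rw [inv_div, inv_div, log_div hnp.ne' p1.ne', log_div hnp.ne' p0.ne']
    field_simp
  rw [c1]
  have b : ∀ a c : ℝ, 0 < a → 0 < c →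
      a * (log n - log a) ≤ a * (log m - log c) + (n * c / m - a) := by
    intro a c ha hc
    have h := Real.log_le_sub_one_of_pos (x := n * c / (m * a)) (by positivity)
    rw [log_div (by positivity) (by positivity), log_mul hnp.ne' hc.ne', log_mul hmp.ne' ha.ne'] at h
    have h2 := mul_le_mul_of_nonneg_left h ha.le
    have h3 : a * (n * c / (m * a) - 1) = n * c / m - a := by field_simp
    nlinarith
  have b0 := b n₀ m₀ p0 q0
  have b1 := b n₁ m₁ p1 q1
  have : n * m₀ / m + n * m₁ / m = n := by field_simp; rw [hm]
  linarith

lemma mul_binEntropy_eq {n₀ n₁ : ℝ} (hn₀ : 0 ≤ n₀) (hn₁ : 0 ≤ n₁) :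
    (n₀ + n₁) * binEntropy (n₁ / (n₀ + n₁)) =
      n₀ * (log (n₀ + n₁) - log n₀) + n₁ * (log (n₀ + n₁) - log n₁) := by
  rcases eq_or_lt_of_le hn₀ with e0 | p0
  · subst e0
    rcases eq_or_lt_of_le hn₁ with e1 | p1
    · subst e1; simp
    · simp [div_self p1.ne']
  rcases eq_or_lt_of_le hn₁ with e1 | p1
  · subst e1; simp
  set n := n₀ + n₁ with hn
  have hnp : 0 < n := by linarith
  have e : 1 - n₁ / n = n₀ / n := by field_simp; linarith
  rw [binEntropy, e, inv_div, inv_div, log_div hnp.ne' p1.ne', log_div hnp.ne' p0.ne']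
  field_simp
  ring

lemma sum_le_sum_of_fiberwise {ι γ : Type*} [DecidableEq γ] (s : Finset ι) (κ : ι → γ)
    (F G : ι → ℝ)
    (h : ∀ x ∈ s, ∑ y ∈ s with κ y = κ x, F y ≤ ∑ y ∈ s with κ y = κ x, G y) :
    ∑ x ∈ s, F x ≤ ∑ x ∈ s, G x := by
  have hm : ∀ x ∈ s, κ x ∈ s.image κ := fun x hx => Finset.mem_image_of_mem κ hx
  rw [← Finset.sum_fiberwise_of_maps_to hm F, ← Finset.sum_fiberwise_of_maps_to hm G]
  refine Finset.sum_le_sum fun k hk => ?_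
  obtain ⟨x, hx, rfl⟩ := Finset.mem_image.1 hk
  exact h x hx

/-! ### Fibres over the later coordinates -/

variable {n : ℕ}

/-- The `j`-th coordinate, read as `0` outside the range of coordinates. -/
def bit (x : Fin n → ZMod 2) (j : ℕ) : ZMod 2 := if h : j < n then x ⟨j, h⟩ else 0

/-- The vector `x` with its first `j` coordinates erased. -/
def tail (j : ℕ) (x : Fin n → ZMod 2) : Fin n → ZMod 2 := fun i => if j ≤ i then x i else 0

/-- The elements of `A` that agree with `x` from coordinate `j` on. -/
def fib (A : Finset (Fin n → ZMod 2)) (j : ℕ) (x : Fin n → ZMod 2) : Finset (Fin n → ZMod 2) :=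
  A.filter fun a => tail j a = tail j x

/-- The number of elements of `fib A (j + 1) x` with `j`-th coordinate `b`. -/
def bitCount (A : Finset (Fin n → ZMod 2)) (j : ℕ) (x : Fin n → ZMod 2) (b : ZMod 2) : ℕ :=
  ((fib A (j + 1) x).filter fun a => bit a j = b).card

/-- The proportion of elements of `fib A (j + 1) x` with `j`-th coordinate `1`. -/
noncomputable def bitMean (A : Finset (Fin n → ZMod 2)) (j : ℕ) (x : Fin n → ZMod 2) : ℝ :=
  bitCount A j x 1 / (bitCount A j x 0 + bitCount A j x 1)

lemma bit_add (x y : Fin n → ZMod 2) (j : ℕ) : bit (x + y) j = bit x j + bit y j := by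
  unfold bit; split_ifs <;> simp

lemma tail_add (j : ℕ) (x y : Fin n → ZMod 2) : tail j (x + y) = tail j x + tail j y := by
  ext i; simp only [tail, Pi.add_apply]; split_ifs <;> simp

lemma tail_eq_iff (j : ℕ) (a x : Fin n → ZMod 2) :
    tail j a = tail j x ↔ ∀ i : Fin n, j ≤ i → a i = x i := by
  constructor
  · intro h i hi
    have := congrFun h i
    simpa [tail, hi] using this
  · intro h
    ext i
    simp only [tail]
    split_ifs with hi
    · rw [h i hi]
    · rfl

lemma tail_eq_iff_succ (j : ℕ) (a x : Fin n → ZMod 2) :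
    tail j a = tail j x ↔ tail (j + 1) a = tail (j + 1) x ∧ bit a j = bit x j := by
  simp only [tail_eq_iff]
  constructor
  · refine fun h => ⟨fun i hi => h i (by omega), ?_⟩
    unfold bit
    split_ifs with hj
    · exact h ⟨j, hj⟩ le_rfl
    · rfl
  · rintro ⟨h1, h2⟩ i hi
    rcases eq_or_lt_of_le hi with e | e
    · have hj : j < n := e ▸ i.2
      have : i = ⟨j, hj⟩ := Fin.ext e.symm
      subst this
      simpa [bit, hj] using h2
    · exact h1 i e

lemma mem_fib {A : Finset (Fin n → ZMod 2)} {j : ℕ} {x a : Fin n → ZMod 2} :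
    a ∈ fib A j x ↔ a ∈ A ∧ tail j a = tail j x := by simp [fib]

lemma fib_congr (A : Finset (Fin n → ZMod 2)) {j : ℕ} {x y : Fin n → ZMod 2}
    (h : tail j x = tail j y) : fib A j x = fib A j y := by simp [fib, h]

lemma bitCount_congr (A : Finset (Fin n → ZMod 2)) {j : ℕ} {x y : Fin n → ZMod 2}
    (h : tail (j + 1) x = tail (j + 1) y) (b : ZMod 2) : bitCount A j x b = bitCount A j y b := by
  simp [bitCount, fib_congr A h]

lemma bitMean_congr (A : Finset (Fin n → ZMod 2)) {j : ℕ} {x y : Fin n → ZMod 2}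
    (h : tail (j + 1) x = tail (j + 1) y) : bitMean A j x = bitMean A j y := by
  simp [bitMean, bitCount_congr A h]

lemma card_fib (A : Finset (Fin n → ZMod 2)) (j : ℕ) (x : Fin n → ZMod 2) :
    (fib A j x).card = bitCount A j x (bit x j) := by
  rw [bitCount, fib, fib, Finset.filter_filter]
  simp only [tail_eq_iff_succ j]

lemma zmod_two_eq_one_iff (b : ZMod 2) : b = 1 ↔ ¬ b = 0 := by
  revert b; decide

lemma sum_fib_bit (A : Finset (Fin n → ZMod 2)) (j : ℕ) (x : Fin n → ZMod 2) (φ : ZMod 2 → ℝ) :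
    ∑ a ∈ fib A (j + 1) x, φ (bit a j) =
      bitCount A j x 0 * φ 0 + bitCount A j x 1 * φ 1 := by
  rw [← Finset.sum_filter_add_sum_filter_not (fib A (j + 1) x) (fun a => bit a j = 0)]
  simp only [← zmod_two_eq_one_iff]
  congr 1
  · rw [Finset.sum_congr rfl (g := fun _ => φ 0)]
    · simp [bitCount]
    · intro a ha; rw [(Finset.mem_filter.1 ha).2]
  · rw [Finset.sum_congr rfl (g := fun _ => φ 1)]
    · simp [bitCount]
    · intro a ha; rw [(Finset.mem_filter.1 ha).2]

lemma card_fib_succ (A : Finset (Fin n → ZMod 2)) (j : ℕ) (x : Fin n → ZMod 2) :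
    ((fib A (j + 1) x).card : ℝ) = bitCount A j x 0 + bitCount A j x 1 := by
  simpa using sum_fib_bit A j x (fun _ => 1)

lemma bitCount_pos_of_mem {A : Finset (Fin n → ZMod 2)} {j : ℕ} {x : Fin n → ZMod 2} {b : ZMod 2}
    {a : Fin n → ZMod 2} (ha : a ∈ A) (h : tail (j + 1) a = tail (j + 1) x) (hb : bit a j = b) :
    0 < bitCount A j x b :=
  Finset.card_pos.2 ⟨a, Finset.mem_filter.2 ⟨mem_fib.2 ⟨ha, h⟩, hb⟩⟩

lemma exists_of_bitCount_pos {A : Finset (Fin n → ZMod 2)} {j : ℕ} {x : Fin n → ZMod 2}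
    {b : ZMod 2} (h : 0 < bitCount A j x b) :
    ∃ a ∈ A, tail (j + 1) a = tail (j + 1) x ∧ bit a j = b := by
  obtain ⟨a, ha⟩ := Finset.card_pos.1 h
  obtain ⟨h1, h2⟩ := Finset.mem_filter.1 ha
  exact ⟨a, (mem_fib.1 h1).1, (mem_fib.1 h1).2, h2⟩

lemma bitCount_add_pos {A B : Finset (Fin n → ZMod 2)} {j : ℕ} {x y : Fin n → ZMod 2}
    {b c : ZMod 2} (hb : 0 < bitCount A j x b) (hc : 0 < bitCount B j y c) :
    0 < bitCount (A + B) j (x + y) (b + c) := by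
  obtain ⟨a, ha, h1, h2⟩ := exists_of_bitCount_pos hb
  obtain ⟨a', ha', h1', h2'⟩ := exists_of_bitCount_pos hc
  exact bitCount_pos_of_mem (Finset.add_mem_add ha ha') (by rw [tail_add, tail_add, h1, h1'])
    (by rw [bit_add, h2, h2'])

/-! ### Chain rule, for A and for the sumset -/

/-- One step of the chain rule for the entropy of a uniform element of `A`. -/
lemma sum_log_card_fib_sub (A : Finset (Fin n → ZMod 2)) (j : ℕ) :
    ∑ x ∈ A, (log (fib A (j + 1) x).card - log (fib A j x).card) =
      ∑ x ∈ A, binEntropy (bitMean A j x) := by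
  have key : ∀ x ∈ A, ∑ y ∈ A with tail (j + 1) y = tail (j + 1) x,
      (log (fib A (j + 1) y).card - log (fib A j y).card) =
      ∑ y ∈ A with tail (j + 1) y = tail (j + 1) x, binEntropy (bitMean A j y) := by
    intro x _
    change ∑ y ∈ fib A (j + 1) x, _ = ∑ y ∈ fib A (j + 1) x, _
    have h1 : ∀ y ∈ fib A (j + 1) x, log (fib A (j + 1) y).card - log (fib A j y).card =
        log (bitCount A j x 0 + bitCount A j x 1) - log (bitCount A j x (bit y j)) := by
      intro y hy
      have hy := (mem_fib.1 hy).2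
      rw [card_fib_succ, card_fib]
      simp only [bitCount_congr A hy]
    have h2 : ∀ y ∈ fib A (j + 1) x, binEntropy (bitMean A j y) = binEntropy (bitMean A j x) := by
      intro y hy
      rw [bitMean_congr A (mem_fib.1 hy).2]
    rw [Finset.sum_congr rfl h1, Finset.sum_congr rfl h2, sum_fib_bit A j x fun b =>
      log (bitCount A j x 0 + bitCount A j x 1) - log (bitCount A j x b), Finset.sum_const,
      nsmul_eq_mul, card_fib_succ, bitMean,
      mul_binEntropy_eq (Nat.cast_nonneg _) (Nat.cast_nonneg _)]
  exact le_antisymm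
    (sum_le_sum_of_fiberwise A (tail (j + 1)) _ _ fun x hx => (key x hx).le)
    (sum_le_sum_of_fiberwise A (tail (j + 1)) _ _ fun x hx => (key x hx).ge)

/-- One step of the entropy lower bound for sumsets. -/
lemma sum_binEntropy_bitConv_le (A B : Finset (Fin n → ZMod 2)) (j : ℕ) :
    ∑ x ∈ A, ∑ y ∈ B, binEntropy (bitConv (bitMean A j x) (bitMean B j y)) ≤
      ∑ x ∈ A, ∑ y ∈ B,
        (log (fib (A + B) (j + 1) (x + y)).card - log (fib (A + B) j (x + y)).card) := by
  rw [← Finset.sum_product', ← Finset.sum_product']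
  refine sum_le_sum_of_fiberwise (A ×ˢ B) (fun z => (tail (j + 1) z.1, tail (j + 1) z.2)) _ _ ?_
  rintro ⟨x, y⟩ hxy
  obtain ⟨hx, hy⟩ := Finset.mem_product.1 hxy
  have hfib : (A ×ˢ B).filter (fun z => (tail (j + 1) z.1, tail (j + 1) z.2) =
      (tail (j + 1) x, tail (j + 1) y)) = fib A (j + 1) x ×ˢ fib B (j + 1) y := by
    ext ⟨a, b⟩
    simp only [Finset.mem_filter, Finset.mem_product, mem_fib, Prod.mk.injEq]
    tauto
  change ∑ z ∈ (A ×ˢ B).filter (fun z => (tail (j + 1) z.1, tail (j + 1) z.2) =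
    (tail (j + 1) x, tail (j + 1) y)), _ ≤ ∑ z ∈ (A ×ˢ B).filter
    (fun z => (tail (j + 1) z.1, tail (j + 1) z.2) = (tail (j + 1) x, tail (j + 1) y)), _
  rw [hfib, Finset.sum_product, Finset.sum_product]
  set M : ZMod 2 → ℕ := bitCount (A + B) j (x + y) with hM
  have h1 : ∀ a ∈ fib A (j + 1) x, ∀ b ∈ fib B (j + 1) y,
      log (fib (A + B) (j + 1) (a + b)).card - log (fib (A + B) j (a + b)).card =
      log (M 0 + M 1) - log (M (bit a j + bit b j)) := by
    intro a ha b hb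
    have hab : tail (j + 1) (a + b) = tail (j + 1) (x + y) := by
      rw [tail_add, tail_add, (mem_fib.1 ha).2, (mem_fib.1 hb).2]
    rw [card_fib_succ, card_fib, bit_add]
    simp only [bitCount_congr (A + B) hab, hM]
  have h2 : ∀ a ∈ fib A (j + 1) x, ∀ b ∈ fib B (j + 1) y,
      binEntropy (bitConv (bitMean A j a) (bitMean B j b)) =
      binEntropy (bitConv (bitMean A j x) (bitMean B j y)) := by
    intro a ha b hb
    rw [bitMean_congr A (mem_fib.1 ha).2, bitMean_congr B (mem_fib.1 hb).2]
  rw [Finset.sum_congr rfl fun a ha => Finset.sum_congr rfl (h1 a ha),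
    Finset.sum_congr rfl fun a ha => Finset.sum_congr rfl (h2 a ha)]
  have h3 : ∀ a ∈ fib A (j + 1) x,
      ∑ b ∈ fib B (j + 1) y, (log (M 0 + M 1) - log (M (bit a j + bit b j))) =
      bitCount B j y 0 * (log (M 0 + M 1) - log (M (bit a j + 0))) +
        bitCount B j y 1 * (log (M 0 + M 1) - log (M (bit a j + 1))) := fun a _ =>
    sum_fib_bit B j y (fun b => log (M 0 + M 1) - log (M (bit a j + b)))
  rw [Finset.sum_congr rfl h3, sum_fib_bit A j x fun c =>
    bitCount B j y 0 * (log (M 0 + M 1) - log (M (c + 0))) +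
      bitCount B j y 1 * (log (M 0 + M 1) - log (M (c + 1)))]
  simp only [Finset.sum_const, nsmul_eq_mul, card_fib_succ]
  have e11 : (1 : ZMod 2) + 1 = 0 := by decide
  simp only [add_zero, zero_add, e11]
  have p00 := @bitCount_add_pos n A B j x y 0 0
  have p01 := @bitCount_add_pos n A B j x y 0 1
  have p10 := @bitCount_add_pos n A B j x y 1 0
  have p11 := @bitCount_add_pos n A B j x y 1 1
  simp only [add_zero, zero_add, e11, ← hM] at p00 p01 p10 p11
  have ha : 0 < (bitCount A j x 0 + bitCount A j x 1 : ℝ) := by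
    rw [← card_fib_succ]
    exact_mod_cast Finset.card_pos.2 ⟨x, mem_fib.2 ⟨hx, rfl⟩⟩
  have hb : 0 < (bitCount B j y 0 + bitCount B j y 1 : ℝ) := by
    rw [← card_fib_succ]
    exact_mod_cast Finset.card_pos.2 ⟨y, mem_fib.2 ⟨hy, rfl⟩⟩
  simp only [bitMean]
  generalize bitCount A j x 0 = a0 at *
  generalize bitCount A j x 1 = a1 at *
  generalize bitCount B j y 0 = b0 at *
  generalize bitCount B j y 1 = b1 at *
  -- The n weights count pairs by the bit of their sum, the m weights count elements of A + B.
  -- Comparing with the uniform measure on A + B avoids the law of the sum itself.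
  have hgibbs := mul_binEntropy_le_cross (n₀ := (a0 * b0 + a1 * b1 : ℕ))
    (n₁ := (a0 * b1 + a1 * b0 : ℕ)) (m₀ := M 0) (m₁ := M 1) (Nat.cast_nonneg _)
    (Nat.cast_nonneg _) (Nat.cast_nonneg _) (Nat.cast_nonneg _)
    (by
      intro h
      have h : 0 < a0 * b0 + a1 * b1 := by exact_mod_cast h
      have : 0 < M 0 := by
        rcases Nat.add_pos_iff_pos_or_pos.1 h with h | h
        · exact p00 (Nat.pos_of_mul_pos_right h) (Nat.pos_of_mul_pos_left h)
        · exact p11 (Nat.pos_of_mul_pos_right h) (Nat.pos_of_mul_pos_left h)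
      exact_mod_cast this)
    (by
      intro h
      have h : 0 < a0 * b1 + a1 * b0 := by exact_mod_cast h
      have : 0 < M 1 := by
        rcases Nat.add_pos_iff_pos_or_pos.1 h with h | h
        · exact p01 (Nat.pos_of_mul_pos_right h) (Nat.pos_of_mul_pos_left h)
        · exact p10 (Nat.pos_of_mul_pos_right h) (Nat.pos_of_mul_pos_left h)
      exact_mod_cast this)
  push_cast at hgibbs
  have e1 : (a0 * b0 + a1 * b1 + (a0 * b1 + a1 * b0) : ℝ) = (a0 + a1) * (b0 + b1) := by ring
  have e2 : ((a0 * b1 + a1 * b0) / ((a0 + a1) * (b0 + b1)) : ℝ) =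
      bitConv (a1 / (a0 + a1)) (b1 / (b0 + b1)) := by
    unfold bitConv; field_simp; ring
  rw [e1, e2] at hgibbs
  linarith

/-! ### Consequences of the downset and shift conditions -/

variable {A : Finset (Fin n → ZMod 2)}

/-- In a downset coordinates may be erased. -/
lemma IsDownset.erase_mem (hA : IsDownset (A : Set (Fin n → ZMod 2))) {a : Fin n → ZMod 2}
    (ha : a ∈ A) (T : Finset (Fin n)) : (fun i => if i ∈ T then 0 else a i) ∈ A := by
  induction T using Finset.induction_on with
  | empty => simpa using ha
  | insert k T hk ih =>
    by_cases h : a k = 0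
    · convert ih using 2 with i
      by_cases hi : i = k
      · subst hi; simp [h]
      · simp [hi]
    · have h1 : a k = 1 := (zmod_two_eq_one_iff _).2 h
      refine hA k _ (by simp) ?_
      convert Finset.mem_coe.2 ih using 1
      ext i
      by_cases hi : i = k
      · subst hi; simp [h1, hk]
      · simp [hi]

/-- Clearing the j-th coordinate is injective on the elements where it is 1 and does not affect the
later ones. -/
lemma IsDownset.bitCount_one_le (hA : IsDownset (A : Set (Fin n → ZMod 2))) (j : ℕ)
    (x : Fin n → ZMod 2) : bitCount A j x 1 ≤ bitCount A j x 0 := by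
  by_cases hj : j < n
  · refine Finset.card_le_card_of_injOn (fun a => a + Pi.single ⟨j, hj⟩ 1) ?_
      (fun a _ b _ h => add_right_cancel h)
    intro a ha
    obtain ⟨h1, h2⟩ := Finset.mem_filter.1 (Finset.mem_coe.1 ha)
    obtain ⟨h3, h4⟩ := mem_fib.1 h1
    have h2' : a ⟨j, hj⟩ = 1 := by simpa [bit, hj] using h2
    have e11 : (1 : ZMod 2) + 1 = 0 := by decide
    refine Finset.mem_coe.2 (Finset.mem_filter.2 ⟨mem_fib.2 ⟨?_, ?_⟩, ?_⟩)
    · refine hA ⟨j, hj⟩ _ (by simp [h2', e11]) ?_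
      have : a + Pi.single ⟨j, hj⟩ 1 + Pi.single ⟨j, hj⟩ 1 = a := by
        rw [add_assoc, ← Pi.single_add, e11, Pi.single_zero, add_zero]
      rwa [this]
    · rw [← h4, tail_eq_iff]
      intro i hi
      have : i ≠ ⟨j, hj⟩ := by rintro rfl; simp at hi
      simp [this]
    · simp [bit, hj, h2', e11]
  · simp [bitCount, bit, hj]

lemma bitMean_nonneg (A : Finset (Fin n → ZMod 2)) (j : ℕ) (x : Fin n → ZMod 2) :
    0 ≤ bitMean A j x := by unfold bitMean; positivity

lemma IsDownset.bitMean_le_half (hA : IsDownset (A : Set (Fin n → ZMod 2))) (j : ℕ)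
    (x : Fin n → ZMod 2) : bitMean A j x ≤ 1 / 2 := by
  have h : (bitCount A j x 1 : ℝ) ≤ bitCount A j x 0 := by
    exact_mod_cast hA.bitCount_one_le j x
  unfold bitMean
  refine div_le_of_le_mul₀ (by positivity) (by norm_num) (by linarith)

/-- Law of total expectation: it reduces monotonicity in j to counting elements with a given bit. -/
lemma sum_bitMean (A : Finset (Fin n → ZMod 2)) (j : ℕ) :
    ∑ x ∈ A, bitMean A j x = ((A.filter fun a => bit a j = 1).card : ℝ) := by
  rw [Finset.card_filter]
  push_cast
  have key : ∀ x ∈ A, ∑ y ∈ A with tail (j + 1) y = tail (j + 1) x, bitMean A j y =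
      ∑ y ∈ A with tail (j + 1) y = tail (j + 1) x, (if bit y j = 1 then (1 : ℝ) else 0) := by
    intro x hx
    change ∑ y ∈ fib A (j + 1) x, _ = ∑ y ∈ fib A (j + 1) x, _
    have h2 : ∀ y ∈ fib A (j + 1) x, bitMean A j y = bitMean A j x := fun y hy =>
      bitMean_congr A (mem_fib.1 hy).2
    have hpos : 0 < (bitCount A j x 0 + bitCount A j x 1 : ℝ) := by
      rw [← card_fib_succ]
      exact_mod_cast Finset.card_pos.2 ⟨x, mem_fib.2 ⟨hx, rfl⟩⟩
    rw [Finset.sum_congr rfl h2, sum_fib_bit A j x fun b => if b = 1 then (1 : ℝ) else 0,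
      Finset.sum_const, nsmul_eq_mul, card_fib_succ, bitMean]
    simp only [if_true, zero_ne_one, if_false]
    field_simp
    ring
  exact le_antisymm
    (sum_le_sum_of_fiberwise A (tail (j + 1)) _ _ fun x hx => (key x hx).le)
    (sum_le_sum_of_fiberwise A (tail (j + 1)) _ _ fun x hx => (key x hx).ge)

/-- Swapping the two coordinates is the injection: it is a permitted shift if the earlier bit is 0
and fixes the vector if both are 1. -/
lemma IsShiftMinimal.card_bit_antitone (hA : IsShiftMinimal (A : Set (Fin n → ZMod 2)))
    {i j : ℕ} (hij : i ≤ j) :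
    (A.filter fun a => bit a j = 1).card ≤ (A.filter fun a => bit a i = 1).card := by
  rcases eq_or_lt_of_le hij with rfl | hij
  · exact le_rfl
  by_cases hj : j < n
  · have hi : i < n := hij.trans hj
    set I : Fin n := ⟨i, hi⟩
    set J : Fin n := ⟨j, hj⟩
    have hIJ : I < J := hij
    refine Finset.card_le_card_of_injOn (fun a => a ∘ Equiv.swap I J) ?_
      (fun a _ b _ h => (Equiv.swap I J).surjective.injective_comp_right h)
    intro a ha
    obtain ⟨h1, h2⟩ := Finset.mem_filter.1 (Finset.mem_coe.1 ha)
    have h2' : a J = 1 := by simpa [bit, hj] using h2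
    refine Finset.mem_coe.2 (Finset.mem_filter.2 ⟨?_, ?_⟩)
    · by_cases h : a I = 0
      · have e := hA I J (fun k => if k = J then 0 else a k) hIJ (by simp [hIJ.ne, h]) (by simp) ?_
        · convert Finset.mem_coe.1 e using 1
          ext k
          by_cases hk : k = I
          · subst hk; simp [h, h2', hIJ.ne]
          · by_cases hk' : k = J
            · subst hk'; simp [h, hIJ.ne']
            · simp [hk, hk', Equiv.swap_apply_of_ne_of_ne hk hk']
        · convert Finset.mem_coe.2 h1 using 1
          ext k
          by_cases hk' : k = J
          · subst hk'; simp [h2']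
          · simp [hk']
      · have h : a I = 1 := (zmod_two_eq_one_iff _).2 h
        have : a ∘ Equiv.swap I J = a := by
          ext k
          by_cases hk : k = I
          · subst hk; simp [h, h2']
          · by_cases hk' : k = J
            · subst hk'; simp [h, h2']
            · simp [Equiv.swap_apply_of_ne_of_ne hk hk']
        change a ∘ Equiv.swap I J ∈ A
        rw [this]; exact h1
    · have : bit (a ∘ Equiv.swap I J) i = (a ∘ Equiv.swap I J) I := by simp [bit, hi, I]
      rw [this]
      simpa using h2'
  · simp [bit, hj]

/-- Elements of one fibre share their coordinates from m on, so erasing these is injective, and the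
result stays in the downset. -/
lemma IsDownset.card_fib_le (hA : IsDownset (A : Set (Fin n → ZMod 2))) (m : ℕ)
    (x : Fin n → ZMod 2) :
    (fib A m x).card ≤ ((A : Set (Fin n → ZMod 2)) ∩
      (initialSubspace n m : Set (Fin n → ZMod 2))).ncard := by
  have e : ((fib A m 0 : Finset (Fin n → ZMod 2)) : Set (Fin n → ZMod 2)) =
      (A : Set (Fin n → ZMod 2)) ∩ (initialSubspace n m : Set (Fin n → ZMod 2)) := by
    ext a
    simp only [mem_fib, tail_eq_iff, Set.mem_inter_iff, SetLike.mem_coe]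
    refine and_congr_right fun _ => ?_
    change _ ↔ ∀ i : Fin n, i ∉ {i : Fin n | (i : ℕ) < m} → a i = 0
    simp
  rw [← e, Set.ncard_coe_finset]
  refine Finset.card_le_card_of_injOn
    (fun a i => if i ∈ Finset.univ.filter (fun i : Fin n => m ≤ i) then 0 else a i) ?_ ?_
  · intro a ha
    refine Finset.mem_coe.2 (mem_fib.2 ⟨hA.erase_mem (mem_fib.1 ha).1 _, ?_⟩)
    rw [tail_eq_iff]
    intro i hi
    simp [hi]
  · intro a ha b hb h
    have h3 := (mem_fib.1 ha).2.trans (mem_fib.1 hb).2.symm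
    rw [tail_eq_iff] at h3
    ext i
    by_cases hi : m ≤ i
    · rw [h3 i hi]
    · simpa [hi] using congrFun h i

lemma fib_top (A : Finset (Fin n → ZMod 2)) (x : Fin n → ZMod 2) : fib A n x = A := by
  ext a
  simp only [mem_fib, tail_eq_iff, and_iff_left_iff_imp]
  intro _ i hi
  omega

lemma card_fib_zero {x : Fin n → ZMod 2} (hx : x ∈ A) : (fib A 0 x).card = 1 := by
  rw [Finset.card_eq_one]
  refine ⟨x, ?_⟩
  ext a
  simp only [mem_fib, tail_eq_iff, Finset.mem_singleton]
  constructor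
  · exact fun h => funext fun i => h.2 i (Nat.zero_le _)
  · rintro rfl; exact ⟨hx, fun _ _ => rfl⟩

/-! ### Summation over the levels -/

/-- The conditional entropy of coordinate `j`, given the later ones, of a uniform element of `A`,
multiplied by the size of `A`. -/
noncomputable def levelEntropy (A : Finset (Fin n → ZMod 2)) (j : ℕ) : ℝ :=
  ∑ x ∈ A, binEntropy (bitMean A j x)

/-- The increase of `levelEntropy A j` on passing to the sum of two independent elements. -/
noncomputable def levelGain (A : Finset (Fin n → ZMod 2)) (j : ℕ) : ℝ :=
  ∑ x ∈ A, ∑ y ∈ A, binEntropy (bitConv (bitMean A j x) (bitMean A j y)) -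
    A.card * levelEntropy A j

lemma sum_log_card_div_fib (A : Finset (Fin n → ZMod 2)) {m : ℕ} (hm : m ≤ n) :
    ∑ x ∈ A, (log A.card - log (fib A m x).card) = ∑ j ∈ Finset.Ico m n, levelEntropy A j := by
  simp only [levelEntropy, ← sum_log_card_fib_sub]
  rw [Finset.sum_comm]
  refine Finset.sum_congr rfl fun x _ => ?_
  rw [Finset.sum_Ico_sub (fun j => log ((fib A j x).card : ℝ)) hm, fib_top]

lemma card_mul_log_card (A : Finset (Fin n → ZMod 2)) :
    A.card * log A.card = ∑ j ∈ Finset.range n, levelEntropy A j := by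
  rw [Finset.range_eq_Ico, ← sum_log_card_div_fib A (Nat.zero_le n),
    Finset.sum_congr rfl (g := fun _ => log A.card)]
  · simp
  · intro x hx; simp [card_fib_zero hx]

/-- The sumset bound telescopes over j, from singletons up to all of A + A. -/
lemma sum_levelGain_le (A : Finset (Fin n → ZMod 2)) :
    ∑ j ∈ Finset.range n, levelGain A j ≤
      (A.card : ℝ) ^ 2 * (log (A + A).card - log A.card) := by
  have h1 : ∑ j ∈ Finset.range n, ∑ x ∈ A, ∑ y ∈ A,
      (log (fib (A + A) (j + 1) (x + y)).card - log (fib (A + A) j (x + y)).card) =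
      (A.card : ℝ) ^ 2 * log (A + A).card := by
    rw [Finset.sum_comm, Finset.sum_congr rfl (g := fun _ => (A.card : ℝ) * log (A + A).card)]
    · simp; ring
    intro x hx
    rw [Finset.sum_comm, Finset.sum_congr rfl (g := fun _ => log ((A + A).card : ℝ))]
    · simp
    intro y hy
    rw [Finset.sum_range_sub (fun j => log ((fib (A + A) j (x + y)).card : ℝ)), fib_top,
      card_fib_zero (Finset.add_mem_add hx hy)]
    simp
  have h2 := Finset.sum_le_sum fun j (_ : j ∈ Finset.range n) => sum_binEntropy_bitConv_le A A j
  rw [h1] at h2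
  simp only [levelGain, Finset.sum_sub_distrib, ← Finset.mul_sum, ← card_mul_log_card]
  linarith

lemma IsDownset.levelGain_nonneg (hA : IsDownset (A : Set (Fin n → ZMod 2))) (j : ℕ) :
    0 ≤ levelGain A j := by
  have : ∑ x ∈ A, ∑ y ∈ A, binEntropy (bitMean A j x) ≤
      ∑ x ∈ A, ∑ y ∈ A, binEntropy (bitConv (bitMean A j x) (bitMean A j y)) :=
    Finset.sum_le_sum fun x _ => Finset.sum_le_sum fun y _ =>
      binEntropy_le_binEntropy_bitConv (bitMean_nonneg A j x) (hA.bitMean_le_half j x)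
        (bitMean_nonneg A j y) (hA.bitMean_le_half j y)
  simp only [Finset.sum_const, nsmul_eq_mul, ← Finset.mul_sum] at this
  simp only [levelGain, levelEntropy]
  linarith

/-- The coordinates beyond `log₂ |A|` carry little entropy. -/
lemma IsSMD.sum_levelEntropy_le (hA : IsSMD (A : Set (Fin n → ZMod 2))) {m : ℕ} (hm : m ≤ n)
    (hmA : log A.card ≤ (m + 1) * log 2) :
    A.card * ∑ j ∈ Finset.Ico m n, levelEntropy A j ≤
      28 * ∑ j ∈ Finset.range n, levelGain A j + (A.card : ℝ) ^ 2 * log 2 := by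
  obtain ⟨hD, hS⟩ := hA
  have hlog2 : 0 ≤ log 2 := Real.log_nonneg (by norm_num)
  have hmono : ∀ {i j : ℕ}, i ≤ j → ∑ x ∈ A, bitMean A j x ≤ ∑ x ∈ A, bitMean A i x := by
    intro i j hij
    rw [sum_bitMean, sum_bitMean]
    exact_mod_cast hS.card_bit_antitone hij
  have hsplit : ∀ f : ℕ → ℝ, ∑ j ∈ Finset.range m, f j + ∑ j ∈ Finset.Ico m n, f j =
      ∑ j ∈ Finset.range n, f j := fun f => Finset.sum_range_add_sum_Ico f hm
  have hg := hsplit (levelGain A)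
  have hg1 : 0 ≤ ∑ j ∈ Finset.range m, levelGain A j :=
    Finset.sum_nonneg fun j _ => hD.levelGain_nonneg j
  have hg2 : 0 ≤ ∑ j ∈ Finset.Ico m n, levelGain A j :=
    Finset.sum_nonneg fun j _ => hD.levelGain_nonneg j
  -- Monotonicity carries a small mean at m to all later levels, and a large one to all earlier
  -- levels.
  rcases le_total (56 * ∑ x ∈ A, bitMean A m x) A.card with h | h
  · have h1 : ∑ j ∈ Finset.Ico m n, A.card * levelEntropy A j ≤
        ∑ j ∈ Finset.Ico m n, 28 * levelGain A j := by
      refine Finset.sum_le_sum fun j hj => ?_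
      have := hmono (Finset.mem_Ico.1 hj).1
      exact sum_binEntropy_le_gain A (bitMean A j) (fun x _ => bitMean_nonneg A j x)
        (fun x _ => hD.bitMean_le_half j x) (by linarith)
    rw [← Finset.mul_sum, ← Finset.mul_sum] at h1
    have : 0 ≤ (A.card : ℝ) ^ 2 * log 2 := by positivity
    linarith
  · have h1 : ∑ j ∈ Finset.range m, A.card * (A.card * log 2 - levelEntropy A j) ≤
        ∑ j ∈ Finset.range m, 28 * levelGain A j := by
      refine Finset.sum_le_sum fun j hj => ?_
      have := hmono (Finset.mem_range.1 hj).le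
      exact log_two_sub_le_gain A (bitMean A j) (fun x _ => bitMean_nonneg A j x)
        (fun x _ => hD.bitMean_le_half j x) (by linarith)
    rw [← Finset.mul_sum, ← Finset.mul_sum, Finset.sum_sub_distrib, Finset.sum_const,
      Finset.card_range, nsmul_eq_mul] at h1
    have he := hsplit (levelEntropy A)
    rw [← card_mul_log_card] at he
    have h2 : (A.card : ℝ) ^ 2 * log A.card ≤ (A.card : ℝ) ^ 2 * ((m + 1) * log 2) :=
      mul_le_mul_of_nonneg_left hmA (by positivity)
    have h3 : (A.card : ℝ) * (∑ j ∈ Finset.range m, levelEntropy A j +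
        ∑ j ∈ Finset.Ico m n, levelEntropy A j) = A.card * (A.card * log A.card) := by rw [he]
    nlinarith

lemma IsSMD.log_card_le (hA : IsSMD (A : Set (Fin n → ZMod 2))) (hne : A.Nonempty) {m : ℕ}
    (hmA : log A.card ≤ (m + 1) * log 2) {s : ℕ}
    (hs : ∀ x, (fib A m x).card ≤ s) :
    log A.card ≤ log s + 28 * (log (A + A).card - log A.card) + log 2 := by
  have hN : 0 < (A.card : ℝ) := by exact_mod_cast hne.card_pos
  have hlog2 : 0 ≤ log 2 := Real.log_nonneg (by norm_num)
  have hK : log A.card ≤ log (A + A).card :=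
    Real.log_le_log hN (by exact_mod_cast Finset.card_le_card_add_right hne)
  rcases le_total m n with hm | hm
  · have h1 := hA.sum_levelEntropy_le hm hmA
    rw [← sum_log_card_div_fib A hm] at h1
    have h2 := sum_levelGain_le A
    have h3 : ∑ x ∈ A, (log A.card - log s) ≤ ∑ x ∈ A, (log A.card - log (fib A m x).card) := by
      refine Finset.sum_le_sum fun x hx => ?_
      have hpos : 0 < ((fib A m x).card : ℝ) := by
        exact_mod_cast Finset.card_pos.2 ⟨x, mem_fib.2 ⟨hx, rfl⟩⟩
      have := Real.log_le_log hpos (Nat.cast_le.2 (hs x))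
      linarith
    rw [Finset.sum_const, nsmul_eq_mul] at h3
    have h4 := mul_le_mul_of_nonneg_left h3 hN.le
    have h5 : (A.card : ℝ) ^ 2 * (log A.card - log s) ≤
        (A.card : ℝ) ^ 2 * (28 * (log (A + A).card - log A.card) + log 2) := by nlinarith
    have := le_of_mul_le_mul_left h5 (by positivity)
    linarith
  · have hAs : A.card ≤ s := by
      have h := hs 0
      have : fib A m 0 = A := by
        ext a
        simp only [mem_fib, tail_eq_iff, and_iff_left_iff_imp]
        intro _ i hi
        omega
      rwa [this] at h
    have := Real.log_le_log hN (by exact_mod_cast hAs : (A.card : ℝ) ≤ s)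
    linarith

end F2Vec

/-! ### The final bound -/

theorem proposition4p1 :
    ∃ c : ℝ, 0 < c ∧
      ∀ (n : ℕ) (A : Finset (Fin n → ZMod 2)) (K : ℝ),
        A.Nonempty →
        F2Vec.IsSMD (A : Set (Fin n → ZMod 2)) →
        ((Finset.addConst A A : ℚ≥0) : ℝ) ≤ K →
        ∀ m : ℕ, m = ⌊Real.logb 2 (A.card : ℝ)⌋₊ →
          c * K ^ (-29 : ℤ) * (A.card : ℝ) ≤
            (((A : Set (Fin n → ZMod 2)) ∩
              (F2Vec.initialSubspace n m : Set (Fin n → ZMod 2))).ncard : ℝ) := by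
  refine ⟨1 / 2, by norm_num, ?_⟩
  intro n A K hne hA hK m hm
  have hN : 0 < (A.card : ℝ) := by exact_mod_cast hne.card_pos
  have hlog2 : 0 < Real.log 2 := Real.log_pos (by norm_num)
  have hmA : Real.log A.card ≤ (m + 1) * Real.log 2 := by
    have h := Nat.lt_floor_add_one (Real.logb 2 (A.card : ℝ))
    rw [← hm, Real.logb, div_lt_iff₀ hlog2] at h
    exact h.le
  set s := ((A : Set (Fin n → ZMod 2)) ∩
    (F2Vec.initialSubspace n m : Set (Fin n → ZMod 2))).ncard
  have hmain := hA.log_card_le hne hmA (s := s) (fun x => hA.1.card_fib_le m x)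
  have hspos : 0 < (s : ℝ) := by
    obtain ⟨x, hx⟩ := hne
    have h : 0 < (F2Vec.fib A m x).card := Finset.card_pos.2 ⟨x, F2Vec.mem_fib.2 ⟨hx, rfl⟩⟩
    exact_mod_cast h.trans_le (hA.1.card_fib_le m x)
  have hcard : ((A + A).card : ℝ) ≤ K * A.card := by
    have h := Finset.addConst_mul_card A A
    have h' : ((Finset.addConst A A : ℚ≥0) : ℝ) * A.card = (A + A).card := by exact_mod_cast h
    rw [← h']
    exact mul_le_mul_of_nonneg_right hK hN.le
  have hAA : (A.card : ℝ) ≤ (A + A).card := by exact_mod_cast Finset.card_le_card_add_right hne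
  have hK1 : 1 ≤ K := by
    by_contra h
    push Not at h
    nlinarith
  have hKpos : 0 < K := by linarith
  have hlogK : Real.log (A + A).card - Real.log A.card ≤ Real.log K := by
    have h := Real.log_le_log (hN.trans_le hAA) hcard
    rw [Real.log_mul hKpos.ne' hN.ne'] at h
    linarith
  have hlogK0 : 0 ≤ Real.log K := Real.log_nonneg hK1
  -- The entropy argument gives exponent 28; 29 follows from log K ≥ 0.
  have hfin : Real.log A.card ≤ Real.log (s * K ^ 29 * 2) := by
    rw [Real.log_mul (by positivity) (by norm_num), Real.log_mul (by positivity) (by positivity),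
      Real.log_pow]
    push_cast
    linarith
  have hfin' := (Real.log_le_log_iff hN (by positivity)).1 hfin
  have e : K ^ (-29 : ℤ) = (K ^ 29)⁻¹ := by
    rw [zpow_neg]; norm_cast
  rw [e]
  have hKp : 0 < K ^ 29 := by positivity
  calc 1 / 2 * (K ^ 29)⁻¹ * (A.card : ℝ)
      ≤ 1 / 2 * (K ^ 29)⁻¹ * (s * K ^ 29 * 2) := by
        exact mul_le_mul_of_nonneg_left hfin' (by positivity)
    _ = s := by field_simp
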